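/- For a colouring $\phi:V\to\{1,\dots,k\}$ of the vertices of a finite graph $G=(V,E)$ and a set $S\subseteq V$, a \emph{centre} of $S$ is a vertex $v\in S$ with $\phi(v)\ne\phi(w)$ for all $w\in S\setminus\{v\}$. The colouring is \emph{centred} if the vertex set of every (non-empty) connected subgraph of $G$ has a centre, and \emph{linear} if the vertex set of every subgraph of $G$ that is a path has a centre. The centred chromatic number $\chi_{\mathrm{cen}}(G)$ and the linear chromatic number $\chi_{\mathrm{lin}}(G)$ are the smallest $k$ for which $G$ has a centred, respectively a linear, colouring with $k$ colours. $\mathcal G(n,p)$ is the binomial random graph on $n$ labelled vertices in which each pair is an edge independently with probability $p$, and "a.a.s." means with probability tending to $1$ as $n\to\infty$. \textbf{Theorem.} (1) Let $\omega=\omega(n)$ be any real function with $\omega(n)\le n$ and $\omega(n)\to\infty$ as $n\to\infty$, and let $p=\omega/n$ (so that $p\in[0,1]$ for all large $n$). Then a.a.s. $$\chi_{\mathrm{lin}}(\mathcal G(n,p))\ \ge\ n-\frac{510\,n}{\sqrt{\omega}}.$$ (2) Consequently, for every $p=p(n)\in[0,1]$ with $np\to\infty$, a.a.s. $\chi_{\mathrm{lin}}(\mathcal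 G(n,p))=(1+o(1))\,n=(1+o(1))\,\chi_{\mathrm{cen}}(\mathcal G(n,p))$; that is, there is a deterministic sequence $\delta_n\to0$ such that a.a.s. $G=\mathcal G(n,p)$ satisfies both $|\chi_{\mathrm{lin}}(G)-n|\le\delta_n n$ and $|\chi_{\mathrm{lin}}(G)-\chi_{\mathrm{cen}}(G)|\le\delta_n\,\chi_{\mathrm{cen}}(G)$. Moreover, a.a.s. $\chi_{\mathrm{cen}}(\mathcal G(n,p))\le 2\,\chi_{\mathrm{lin}}(\mathcal G(n,p))$. (3) In particular, the inequality $\chi_{\mathrm{cen}}(G)\le 2\,\chi_{\mathrm{lin}}(G)$, conjectured by Kun, O'Brien, Pilipczuk and Sullivan for all graphs, holds for almost all graphs: the proportion of the graphs $G$ on $n$ labelled vertices that satisfy it tends to $1$ as $n\to\infty$. -/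

import Mathlib

open Filter Topology

namespace LinearColouring

/-- `v` is a centre for the vertex set `S` under `φ`: it lies in `S`, and no other vertex of `S`
has the colour of `v`. -/
def IsCentre {V α : Type*} (φ : V → α) (S : Set V) (v : V) : Prop :=
  v ∈ S ∧ ∀ w ∈ S, w ≠ v → φ v ≠ φ w

/-- The colouring `φ` of `G` is centred: the vertex set of every connected subgraph of `G`
(connected subgraphs are non-empty) has a centre. -/
def IsCentred {V α : Type*} (G : SimpleGraph V) (φ : V → α) : Prop :=
  ∀ H : G.Subgraph, H.Connected → ∃ v, IsCentre φ H.verts v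

/-- The colouring `φ` of `G` is linear: the vertex set of every path of `G` has a centre. -/
def IsLinear {V α : Type*} (G : SimpleGraph V) (φ : V → α) : Prop :=
  ∀ (a b : V) (P : G.Walk a b), P.IsPath → ∃ v, IsCentre φ {x | x ∈ P.support} v

/-- The centred chromatic number of a finite graph: the least `k` such that there is a centred
colouring with `k` colours. -/
noncomputable def centredChromaticNumber {V : Type*} [Finite V] (G : SimpleGraph V) : ℕ :=
  sInf {k : ℕ | ∃ φ : V → Fin k, IsCentred G φ}

/-- The linear chromatic number of a finite graph: the least `k` such that there is a linear
colouring with `k` colours. -/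
noncomputable def linearChromaticNumber {V : Type*} [Finite V] (G : SimpleGraph V) : ℕ :=
  sInf {k : ℕ | ∃ φ : V → Fin k, IsLinear G φ}

/-- The infimum in the definition of the centred chromatic number is attained. -/
theorem exists_isCentred {V : Type*} [Finite V] (G : SimpleGraph V) :
    ∃ φ : V → Fin (centredChromaticNumber G), IsCentred G φ := by
  have h : {k : ℕ | ∃ φ : V → Fin k, IsCentred G φ}.Nonempty := by
    refine ⟨Nat.card V, Finite.equivFin V, fun H hH => ?_⟩
    obtain ⟨v, hv⟩ := hH.nonempty
    exact ⟨v, hv, fun w _ hwv h => hwv ((Finite.equivFin V).injective h).symm⟩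
  exact Nat.sInf_mem h

/-- The infimum in the definition of the linear chromatic number is attained. -/
theorem exists_isLinear {V : Type*} [Finite V] (G : SimpleGraph V) :
    ∃ φ : V → Fin (linearChromaticNumber G), IsLinear G φ := by
  have h : {k : ℕ | ∃ φ : V → Fin k, IsLinear G φ}.Nonempty := by
    refine ⟨Nat.card V, Finite.equivFin V, fun a b P _ => ⟨a, P.start_mem_support, ?_⟩⟩
    exact fun w _ hwv h => hwv ((Finite.equivFin V).injective h).symm
  exact Nat.sInf_mem h

/-- The binomial random graph `G(n, p n)` has the property `Q n` asymptotically almost surely. -/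
def AAS (p : ℕ → unitInterval) (Q : ∀ n : ℕ, SimpleGraph (Fin n) → Prop) : Prop :=
  Tendsto (fun n : ℕ => (SimpleGraph.binomialRandom (Fin n) (p n)).real {G | Q n G}) atTop (𝓝 1)

/-- Almost all (labelled) graphs have the property `Q`: the proportion of the graphs on `n`
labelled vertices that have it tends to `1`. -/
def AlmostAllGraphs (Q : ∀ n : ℕ, SimpleGraph (Fin n) → Prop) : Prop :=
  Tendsto (fun n : ℕ => ({G : SimpleGraph (Fin n) | Q n G}.ncard : ℝ) /
    (Nat.card (SimpleGraph (Fin n)) : ℝ)) atTop (𝓝 1)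

end LinearColouring

/-! Two-round exposure writes the random graph as `S ∪ T`, with `S` and `T` independent of edge
probability `q ≥ p / 2`. Put `s ≈ 50 n / √ω` and `m ≈ 510 n / √ω`. With high probability `S` has an
edge between any two disjoint `s`-sets of vertices (`Joined`).

Suppose that `S ∪ T` has a linear colouring with at most `n - m` colours. Pairing off vertices of
equal colour gives a colour-preserving involution `τ` that moves at least `m - 1 ≥ 9 s` vertices
(`exists_involution`). Deleting a maximal badly expanding set together with its `τ`-image leaves a
nonempty `τ`-invariant set `U` on which `S` expands (`Joined.exists_expands`). A path of the graph
with vertex set `U` would have no centre, since every vertex of `U` has a partner of its colour in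
`U`; so there is no such path.

Pósa rotations show that as long as `S ∪ F` has no path through `U`, there are at least `s² / 2`
pairs ("boosters") each of which improves the best listing of `U`. Adding boosters from `T` one by
one must therefore get stuck: some `F ⊆ T` with at most `m` edges is such that `T` misses all
boosters of `S ∪ F` (`Joined.exists_stuck`).

For fixed `S`, `U` and `F` this has probability at most `q ^ |F| * exp (-q s² / 2)`. The union bound
ranges over `U` and `F` only, never over colourings or involutions, and `q s² ≥ 1250 n` beats the
number of choices. The remaining claims follow from `χ_lin ≤ χ_cen ≤ n`; almost all graphs is the
case `p = 1/2`. -/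

namespace LinearColouring

/-! ### Random subsets of a finite set as weighted sums. -/

section RandomSets

variable {ι : Type*} [DecidableEq ι]

/-- The expectation of `f S` for a random subset `S` of `E` that contains each element of `E`
independently with probability `q`. -/
noncomputable def subsetExpect (q : ℝ) (E : Finset ι) (f : Finset ι → ℝ) : ℝ :=
  ∑ S ∈ E.powerset, q ^ S.card * (1 - q) ^ (E \ S).card * f S

theorem subsetExpect_insert (q : ℝ) {E : Finset ι} {e : ι} (he : e ∉ E) (f : Finset ι → ℝ) :
    subsetExpect q (insert e E) f =
      (1 - q) * subsetExpect q E f + q * subsetExpect q E (fun S => f (insert e S)) := by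
  unfold subsetExpect
  rw [Finset.sum_powerset_insert he, Finset.mul_sum, Finset.mul_sum]
  congr 1 <;> refine Finset.sum_congr rfl fun S hS => ?_
  · have heS : e ∉ S := fun h => he (Finset.mem_powerset.1 hS h)
    rw [Finset.insert_sdiff_of_notMem _ heS, Finset.card_insert_of_notMem (by simp [he])]
    ring
  · have heS : e ∉ S := fun h => he (Finset.mem_powerset.1 hS h)
    rw [Finset.card_insert_of_notMem heS, Finset.insert_sdiff_insert,
      Finset.sdiff_insert_of_notMem he]
    ring

theorem subsetExpect_mono {q : ℝ} (h0 : 0 ≤ q) (h1 : q ≤ 1) {E : Finset ι} {f g : Finset ι → ℝ}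
    (h : ∀ S ⊆ E, f S ≤ g S) : subsetExpect q E f ≤ subsetExpect q E g := by
  have : 0 ≤ 1 - q := by linarith
  refine Finset.sum_le_sum fun S hS => ?_
  have := h S (Finset.mem_powerset.1 hS)
  gcongr

theorem subsetExpect_add (q : ℝ) (E : Finset ι) (f g : Finset ι → ℝ) :
    subsetExpect q E (fun S => f S + g S) = subsetExpect q E f + subsetExpect q E g := by
  simp only [subsetExpect, mul_add, Finset.sum_add_distrib]

theorem subsetExpect_const_mul (q : ℝ) (E : Finset ι) (c : ℝ) (f : Finset ι → ℝ) :
    subsetExpect q E (fun S => c * f S) = c * subsetExpect q E f := by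
  simp only [subsetExpect, Finset.mul_sum]
  exact Finset.sum_congr rfl fun S _ => by ring

theorem subsetExpect_sum {κ : Type*} (q : ℝ) (E : Finset ι) (I : Finset κ)
    (f : κ → Finset ι → ℝ) :
    subsetExpect q E (fun S => ∑ i ∈ I, f i S) = ∑ i ∈ I, subsetExpect q E (f i) := by
  simp only [subsetExpect, Finset.mul_sum]
  exact Finset.sum_comm

theorem subsetExpect_const (q : ℝ) (E : Finset ι) (c : ℝ) :
    subsetExpect q E (fun _ => c) = c := by
  induction E using Finset.induction_on with
  | empty => simp [subsetExpect]
  | insert e E he ih => rw [subsetExpect_insert q he, ih]; ring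

/-- Exposing a random set in two rounds. -/
theorem subsetExpect_union {p q : ℝ} (hpq : 1 - p = (1 - q) ^ 2) (E : Finset ι)
    (f : Finset ι → ℝ) :
    subsetExpect p E f = subsetExpect q E fun S => subsetExpect q E fun T => f (S ∪ T) := by
  induction E using Finset.induction_on generalizing f with
  | empty => simp [subsetExpect]
  | insert e E he ih =>
    rw [subsetExpect_insert p he, subsetExpect_insert q he]
    simp only [subsetExpect_insert q he, Finset.insert_union, Finset.union_insert,
      Finset.insert_idem, subsetExpect_add, subsetExpect_const_mul]
    rw [ih f, ih fun S => f (insert e S)]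
    -- The element `e` is missed by both rounds with weight `(1 - q) ^ 2`; the three other cases all
    -- lead to `insert e` and together have weight `p`.
    have hp : p = 1 - (1 - q) ^ 2 := by linarith
    rw [hp]
    ring

/-- The probability that a random set contains `F` and misses `B`. -/
theorem subsetExpect_cylinder (q : ℝ) {E F B : Finset ι} (hF : F ⊆ E) (hB : B ⊆ E)
    (hFB : Disjoint F B) :
    subsetExpect q E (fun S => if F ⊆ S ∧ Disjoint B S then 1 else 0) =
      q ^ F.card * (1 - q) ^ B.card := by
  -- Multiplying out the product over `E` sums over all `S`; the zeros placed on `B` and on `F` kill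
  -- exactly those `S` that meet `B` or fail to contain `F`.
  have h := Finset.prod_add (fun e => if e ∈ B then 0 else q)
    (fun e => if e ∈ F then 0 else 1 - q) E
  have h1 : ∏ e ∈ E, ((if e ∈ B then 0 else q) + (if e ∈ F then 0 else 1 - q)) =
      q ^ F.card * (1 - q) ^ B.card := by
    have h2 : ∀ e ∈ E, ((if e ∈ B then 0 else q) + (if e ∈ F then 0 else 1 - q)) =
        (if e ∈ F then q else 1) * (if e ∈ B then 1 - q else 1) := by
      intro e _
      by_cases heF : e ∈ F
      · simp [heF, Finset.disjoint_left.1 hFB heF]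
      · by_cases heB : e ∈ B <;> simp [heF, heB]
    rw [Finset.prod_congr rfl h2, Finset.prod_mul_distrib, Finset.prod_ite_mem,
      Finset.prod_ite_mem, Finset.inter_eq_right.2 hF, Finset.inter_eq_right.2 hB]
    simp
  rw [← h1, h]
  refine Finset.sum_congr rfl fun S hS => ?_
  beta_reduce
  by_cases hBS : Disjoint B S
  · have e1 : ∏ e ∈ S, (if e ∈ B then 0 else q) = q ^ S.card := by
      rw [← Finset.prod_const]
      exact Finset.prod_congr rfl fun e he => if_neg (Finset.disjoint_right.1 hBS he)
    rw [e1]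
    by_cases hFS : F ⊆ S
    · have e2 : ∏ e ∈ E \ S, (if e ∈ F then 0 else 1 - q) = (1 - q) ^ (E \ S).card := by
        rw [← Finset.prod_const]
        exact Finset.prod_congr rfl fun e he =>
          if_neg fun h => (Finset.mem_sdiff.1 he).2 (hFS h)
      rw [e2, if_pos ⟨hFS, hBS⟩, mul_one]
    · rw [if_neg (fun h => hFS h.1), mul_zero]
      obtain ⟨e, heF, heS⟩ := Finset.not_subset.1 hFS
      have hz : ∏ e ∈ E \ S, (if e ∈ F then 0 else 1 - q) = 0 :=
        Finset.prod_eq_zero (Finset.mem_sdiff.2 ⟨hF heF, heS⟩) (if_pos heF)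
      rw [hz, mul_zero]
  · rw [if_neg (fun h => hBS h.2), mul_zero]
    obtain ⟨e, heB, heS⟩ := Finset.not_disjoint_iff.1 hBS
    have hz : ∏ e ∈ S, (if e ∈ B then 0 else q) = 0 := Finset.prod_eq_zero heS (if_pos heB)
    rw [hz, zero_mul]

end RandomSets

/-- An upper bound for the expected number of subsets with at most `m` elements of a random
set. -/
theorem sum_pow_card_le {ι : Type*} {q w : ℝ} (hq : 0 ≤ q) (hw : 1 ≤ w) (E : Finset ι) (m : ℕ) :
    ∑ F ∈ E.powerset with F.card ≤ m, q ^ F.card ≤ w ^ m * Real.exp (q / w * E.card) := by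
  have hw0 : 0 < w := by linarith
  calc ∑ F ∈ E.powerset with F.card ≤ m, q ^ F.card
      ≤ ∑ F ∈ E.powerset with F.card ≤ m, w ^ m * (q / w) ^ F.card := by
        -- Since `1 ≤ w`, the bound on the size of `F` turns `w ^ F.card` into `w ^ m`; the
        -- restriction on `F` can then be dropped and the binomial theorem applies to `q / w`.
        refine Finset.sum_le_sum fun F hF => ?_
        have hFm := (Finset.mem_filter.1 hF).2
        calc q ^ F.card = w ^ F.card * (q / w) ^ F.card := by
              rw [← mul_pow, mul_div_cancel₀ _ hw0.ne']
          _ ≤ w ^ m * (q / w) ^ F.card := by gcongr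
    _ ≤ ∑ F ∈ E.powerset, w ^ m * (q / w) ^ F.card :=
        Finset.sum_le_sum_of_subset_of_nonneg (Finset.filter_subset _ _)
          fun F _ _ => by positivity
    _ = w ^ m * (q / w + 1) ^ E.card := by
        rw [← Finset.mul_sum, ← Finset.sum_pow_mul_eq_add_pow]
        simp
    _ ≤ w ^ m * Real.exp (q / w * E.card) := by
        rw [mul_comm (q / w), Real.exp_nat_mul]
        gcongr
        exact Real.add_one_le_exp _

/-! ### The binomial random graph as a random set of pairs. -/

section RandomGraphs

variable {V : Type*} [Fintype V] [DecidableEq V]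

omit [Fintype V] [DecidableEq V] in
theorem measurableSingletonClass_simpleGraph [Countable V] :
    MeasurableSingletonClass (SimpleGraph V) :=
  ⟨fun G => by
    rw [← SimpleGraph.measurableEmbedding_edgeSet.measurableSet_image, Set.image_singleton]
    exact measurableSet_singleton _⟩

/-- The set of all pairs of distinct vertices. -/
def allPairs (V : Type*) [Fintype V] [DecidableEq V] : Finset (Sym2 V) :=
  Finset.univ.filter fun e => ¬ e.IsDiag

theorem card_allPairs : (allPairs V).card = (Fintype.card V).choose 2 := by
  rw [← Sym2.card_subtype_not_diag, Fintype.card_subtype, allPairs]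

-- Passing from graphs to their edge sets replaces the measure by a finite sum, so that two-round
-- exposure and independence are available as identities for `subsetExpect`.
open Classical in
theorem binomialRandom_real_eq (p : unitInterval) (Q : Set (SimpleGraph V)) :
    (SimpleGraph.binomialRandom V p).real Q = subsetExpect (p : ℝ) (allPairs V)
      (fun S => if SimpleGraph.fromEdgeSet (S : Set (Sym2 V)) ∈ Q then 1 else 0) := by
  have hmem : ∀ G : SimpleGraph V, ∀ e ∈ G.edgeSet, e ∈ allPairs V := fun G e he =>
    Finset.mem_filter.2 ⟨Finset.mem_univ _, G.not_isDiag_of_mem_edgeSet he⟩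
  have hedge : ∀ S ∈ (allPairs V).powerset,
      (SimpleGraph.fromEdgeSet (S : Set (Sym2 V))).edgeSet = S := by
    intro S hS
    rw [SimpleGraph.edgeSet_fromEdgeSet, sdiff_eq_left, Set.disjoint_left]
    intro e he
    exact (Finset.mem_filter.1 (Finset.mem_powerset.1 hS he)).2
  have := measurableSingletonClass_simpleGraph (V := V)
  rw [← Q.toFinite.coe_toFinset, ← MeasureTheory.sum_measureReal_singleton]
  simp only [subsetExpect, mul_ite, mul_one, mul_zero, ← Finset.sum_filter]
  refine Finset.sum_nbij' (fun G => G.edgeSet.toFinset)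
    (fun S => SimpleGraph.fromEdgeSet (S : Set (Sym2 V))) ?_ ?_ ?_ ?_ ?_
  · intro G hG
    refine Finset.mem_filter.2 ⟨Finset.mem_powerset.2 fun e he => hmem G e (by simpa using he), ?_⟩
    simpa using hG
  · intro S hS
    simpa using (Finset.mem_filter.1 hS).2
  · intro G _
    simp
  · intro S hS
    simp [hedge S (Finset.mem_filter.1 hS).1]
  · intro G _
    have hsub : G.edgeSet.toFinset ⊆ allPairs V := fun e he => hmem G e (by simpa using he)
    rw [MeasureTheory.measureReal_def, SimpleGraph.binomialRandom_singleton,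
      Finset.card_sdiff_of_subset hsub, card_allPairs, Set.ncard_eq_toFinset_card',
      Nat.card_eq_fintype_card]
    simp

end RandomGraphs

/-! ### Consecutive pairs in lists, and how many of them are edges. -/

section Lists

variable {V : Type*}

/-- `u` and `v` are consecutive in the list `l`, in one order or the other. -/
def Linked (l : List V) (u v : V) : Prop := [u, v] <:+: l ∨ [v, u] <:+: l

theorem pair_infix_append {a b : List V} {u v : V} (h : [u, v] <:+: a ++ b) :
    [u, v] <:+: a ∨ [u, v] <:+: b ∨ (a.getLast? = some u ∧ b.head? = some v) := by
  induction a with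
  | nil => exact Or.inr (Or.inl h)
  | cons x a ih =>
    rw [List.cons_append, List.infix_cons_iff] at h
    rcases h with h | h
    · rw [List.cons_prefix_cons] at h
      obtain ⟨rfl, h⟩ := h
      cases a with
      | nil =>
        cases b with
        | nil => simp at h
        | cons y b => simp_all
      | cons y a =>
        rw [List.cons_append, List.cons_prefix_cons] at h
        obtain ⟨rfl, -⟩ := h
        exact Or.inl ⟨[], a, rfl⟩
    · rcases ih h with h | h | h
      · exact Or.inl (h.trans (List.suffix_cons _ _).isInfix)
      · exact Or.inr (Or.inl h)
      · refine Or.inr (Or.inr ⟨?_, h.2⟩)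
        cases a with
        | nil => simp at h
        | cons y a => simpa [List.getLast?_cons_cons] using h.1

theorem Linked.reverse {l : List V} {u v : V} (h : Linked l.reverse u v) : Linked l u v := by
  rcases h with h | h
  · exact Or.inr (by rw [← List.reverse_infix]; simpa using h)
  · exact Or.inl (by rw [← List.reverse_infix]; simpa using h)

theorem Linked.append_left {a b : List V} {u v : V} (h : Linked a u v) : Linked (a ++ b) u v :=
  h.imp (fun h => h.trans List.infix_append_left) (fun h => h.trans List.infix_append_left)

theorem Linked.append_right {a b : List V} {u v : V} (h : Linked b u v) : Linked (a ++ b) u v :=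
  h.imp (fun h => h.trans List.infix_append_right) (fun h => h.trans List.infix_append_right)

theorem linked_append {a b : List V} {u v : V} (h : Linked (a ++ b) u v) :
    Linked a u v ∨ Linked b u v ∨ (a.getLast? = some u ∧ b.head? = some v) ∨
      (a.getLast? = some v ∧ b.head? = some u) := by
  rcases h with h | h
  · rcases pair_infix_append h with h | h | h
    exacts [Or.inl (Or.inl h), Or.inr (Or.inl (Or.inl h)), Or.inr (Or.inr (Or.inl h))]
  · rcases pair_infix_append h with h | h | h
    exacts [Or.inl (Or.inr h), Or.inr (Or.inl (Or.inr h)), Or.inr (Or.inr (Or.inr h))]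

theorem linked_append_of_ends {a b : List V} {u v : V} (ha : a.getLast? = some u)
    (hb : b.head? = some v) : Linked (a ++ b) u v := by
  obtain ⟨a', rfl⟩ := List.getLast?_eq_some_iff.1 ha
  obtain ⟨b', rfl⟩ := List.head?_eq_some_iff.1 hb
  exact Or.inl ⟨a', b', by simp⟩

theorem next_unique_of_nodup {l : List V} (hl : l.Nodup) {u v w : V} (hv : [u, v] <:+: l)
    (hw : [u, w] <:+: l) : v = w := by
  induction l with
  | nil => simp at hv
  | cons x l ih =>
    rw [List.nodup_cons] at hl
    rw [List.infix_cons_iff, List.cons_prefix_cons] at hv hw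
    rcases hv with ⟨rfl, hv⟩ | hv <;> rcases hw with ⟨hx, hw⟩ | hw
    · obtain ⟨a, ha⟩ := hv
      obtain ⟨b, hb⟩ := hw
      exact (show v = w ∧ a = b by simpa using ha.trans hb.symm).1
    · exact absurd (hw.subset (by simp)) hl.1
    · exact absurd (hv.subset (by simp [hx])) hl.1
    · exact ih hl.2 hv hw

/-- At most `2 * #S` elements are linked to an element of `S`. -/
theorem card_linked_le [DecidableEq V] {l : List V} (hl : l.Nodup) (S T : Finset V)
    (hT : ∀ v ∈ T, ∃ u ∈ S, Linked l u v) : T.card ≤ 2 * S.card := by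
  classical
  have key : ∀ R : V → V → Prop, (∀ u v w, R u v → R u w → v = w) → ∀ T' : Finset V,
      (∀ v ∈ T', ∃ u ∈ S, R u v) → T'.card ≤ S.card := by
    intro R hR T' hT'
    choose! f hf using hT'
    refine Finset.card_le_card_of_injOn f (fun v hv => (hf v hv).1) ?_
    intro v hv w hw e
    exact hR (f v) v w (hf v hv).2 (e ▸ (hf w hw).2)
  have h1 := key (fun u v => [u, v] <:+: l) (fun u v w => next_unique_of_nodup hl)
    (T.filter fun v => ∃ u ∈ S, [u, v] <:+: l) (by simp)
  have h2 := key (fun u v => [v, u] <:+: l) (fun u v w h h' =>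
      next_unique_of_nodup (List.nodup_reverse.2 hl) (u := u)
        (by rw [← List.reverse_infix]; simpa using h) (by rw [← List.reverse_infix]; simpa using h'))
    (T.filter fun v => ∃ u ∈ S, [v, u] <:+: l) (by simp)
  have h3 : T ⊆ (T.filter fun v => ∃ u ∈ S, [u, v] <:+: l) ∪
      (T.filter fun v => ∃ u ∈ S, [v, u] <:+: l) := by
    intro v hv
    obtain ⟨u, hu, h | h⟩ := hT v hv
    · exact Finset.mem_union_left _ (Finset.mem_filter.2 ⟨hv, u, hu, h⟩)
    · exact Finset.mem_union_right _ (Finset.mem_filter.2 ⟨hv, u, hu, h⟩)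
  have := (Finset.card_le_card h3).trans (Finset.card_union_le _ _)
  omega

open Classical in
/-- The number of consecutive pairs of the list that are edges of the graph. -/
noncomputable def realLinks (H : SimpleGraph V) : List V → ℕ
  | [] => 0
  | [_] => 0
  | x :: y :: l => (if H.Adj x y then 1 else 0) + realLinks H (y :: l)

open Classical in
theorem realLinks_append (H : SimpleGraph V) (a b : List V) (x y : V) :
    realLinks H (a ++ x :: y :: b) =
      realLinks H (a ++ [x]) + (if H.Adj x y then 1 else 0) + realLinks H (y :: b) := by
  induction a with
  | nil => simp [realLinks]
  | cons z a ih =>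
    cases a with
    | nil => simp [realLinks]; ring
    | cons w a => simp only [List.cons_append, realLinks] at ih ⊢; rw [ih]; ring

theorem realLinks_reverse (H : SimpleGraph V) (l : List V) :
    realLinks H l.reverse = realLinks H l := by
  classical
  induction l with
  | nil => rfl
  | cons x l ih =>
    cases l with
    | nil => rfl
    | cons y l =>
      have := realLinks_append H l.reverse [] y x
      simp only [realLinks] at this ⊢
      simp only [List.reverse_cons, List.append_assoc, List.cons_append, List.nil_append] at this ih ⊢
      rw [this, ih, H.adj_comm]; ring

theorem realLinks_mono {H H' : SimpleGraph V} (h : H ≤ H') (l : List V) :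
    realLinks H l ≤ realLinks H' l := by
  classical
  induction l with
  | nil => rfl
  | cons x l ih =>
    cases l with
    | nil => rfl
    | cons y l =>
      simp only [realLinks]
      have : H.Adj x y → H'.Adj x y := fun e => h e
      split_ifs <;> simp_all; omega

/-- A list is a chain of adjacent vertices or has a consecutive pair of nonadjacent vertices. -/
theorem isChain_or_exists_not_adj (H : SimpleGraph V) (l : List V) :
    l.IsChain H.Adj ∨ ∃ a b x y, l = a ++ x :: y :: b ∧ ¬ H.Adj x y := by
  induction l with
  | nil => exact Or.inl .nil
  | cons x l ih =>
    cases l with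
    | nil => exact Or.inl (.singleton _)
    | cons y l =>
      by_cases hxy : H.Adj x y
      · rcases ih with ih | ⟨a, b, u, v, h, huv⟩
        · exact Or.inl (.cons_cons hxy ih)
        · exact Or.inr ⟨x :: a, b, u, v, by rw [h]; rfl, huv⟩
      · exact Or.inr ⟨[], l, x, y, rfl, hxy⟩

theorem realLinks_of_isChain (H : SimpleGraph V) {l : List V} (h : l.IsChain H.Adj) :
    realLinks H l = l.length - 1 := by
  classical
  induction l with
  | nil => rfl
  | cons x l ih =>
    cases l with
    | nil => rfl
    | cons y l =>
      rw [List.isChain_cons_cons] at h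
      simp only [realLinks, h.1, if_true, ih h.2]
      simp; omega

theorem realLinks_le (H : SimpleGraph V) (l : List V) :
    realLinks H l ≤ l.length - 1 := by
  classical
  induction l with
  | nil => rfl
  | cons x l ih =>
    cases l with
    | nil => rfl
    | cons y l =>
      simp only [realLinks, List.length_cons] at ih ⊢
      split_ifs <;> omega

theorem isChain_of_le_realLinks (H : SimpleGraph V) {l : List V}
    (h : l.length - 1 ≤ realLinks H l) : l.IsChain H.Adj := by
  classical
  rcases isChain_or_exists_not_adj H l with h' | ⟨a, b, x, y, rfl, hxy⟩
  · exact h'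
  · rw [realLinks_append, if_neg hxy] at h
    have h1 := realLinks_le H (a ++ [x])
    have h2 := realLinks_le H (y :: b)
    simp at h h1 h2
    omega

end Lists

/-! ### Pósa rotations of vertex listings that may contain non-edges. -/

section Rotations

variable {V : Type*}

/-- `l'` arises from `l` by a rotation: a prefix of `l` is reversed whose first vertex is
adjacent to the first vertex after the prefix. -/
def Rotation (H : SimpleGraph V) (l l' : List V) : Prop :=
  ∃ (a b : List V) (x z : V), l = a ++ z :: b ∧ l' = a.reverse ++ z :: b ∧ a.head? = some x ∧
    H.Adj x z

/-- The only link lost is the one from the end of the prefix to `z`, which counts at most 1; the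
link gained is `xz`, an edge. Hence rotations are harmless even for listings with gaps, and no
longest path need be considered. -/
theorem Rotation.realLinks_le {H : SimpleGraph V} {l l' : List V} (h : Rotation H l l') :
    realLinks H l ≤ realLinks H l' := by
  classical
  obtain ⟨a, b, x, z, rfl, rfl, ha, hxz⟩ := h
  obtain ⟨a', rfl⟩ := List.head?_eq_some_iff.1 ha
  have h1 := realLinks_append H a'.reverse b x z
  rw [if_pos hxz] at h1
  have h2 : realLinks H (a'.reverse ++ [x]) = realLinks H (x :: a') := by
    rw [← realLinks_reverse]; simp
  rw [h2] at h1
  obtain ⟨c, w, hc⟩ : ∃ c w, x :: a' = c ++ [w] := by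
    rcases List.eq_nil_or_concat (x :: a') with h | ⟨c, w, h⟩
    · simp at h
    · exact ⟨c, w, by simpa using h⟩
  have h3 := realLinks_append H c b w z
  rw [← hc] at h3
  have h4 : (x :: a') ++ z :: b = c ++ w :: z :: b := by rw [hc]; simp
  rw [h4, h3]
  simp only [List.reverse_cons, List.append_assoc, List.cons_append, List.nil_append]
  rw [h1]
  split_ifs <;> omega

theorem Rotation.perm {H : SimpleGraph V} {l l' : List V} (h : Rotation H l l') :
    l'.Perm l := by
  obtain ⟨a, b, x, z, rfl, rfl, -, -⟩ := h
  exact (List.reverse_perm a).append_right _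

theorem Rotation.getLast? {H : SimpleGraph V} {l l' : List V} (h : Rotation H l l') :
    l'.getLast? = l.getLast? := by
  obtain ⟨a, b, x, z, rfl, rfl, -, -⟩ := h
  rw [List.getLast?_append, List.getLast?_append,
    List.getLast?_eq_some_getLast (List.cons_ne_nil z b)]
  rfl

/-- `l'` arises from `l` by a sequence of rotations. -/
def Rotations (H : SimpleGraph V) : List V → List V → Prop := Relation.ReflTransGen (Rotation H)

theorem Rotations.realLinks_le {H : SimpleGraph V} {l l' : List V} (h : Rotations H l l') :
    realLinks H l ≤ realLinks H l' := by
  induction h with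
  | refl => exact le_rfl
  | tail _ h ih => exact ih.trans h.realLinks_le

theorem Rotations.perm {H : SimpleGraph V} {l l' : List V} (h : Rotations H l l') :
    l'.Perm l := by
  induction h with
  | refl => exact .refl _
  | tail _ h ih => exact h.perm.trans ih

theorem Rotations.getLast? {H : SimpleGraph V} {l l' : List V} (h : Rotations H l l') :
    l'.getLast? = l.getLast? := by
  induction h with
  | refl => rfl
  | tail _ h ih => exact h.getLast?.trans ih

/-- The set of the first vertices of the lists that arise from `l` by rotations. -/
def endpoints (H : SimpleGraph V) (l : List V) : Set V :=
  {v | ∃ l', Rotations H l l' ∧ l'.head? = some v}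

/-- Under rotations, a vertex that is neither an endpoint nor linked to one gets no new links. -/
theorem Rotations.linked {H : SimpleGraph V} {l l' : List V} (h : Rotations H l l') {v : V}
    (hv : v ∉ endpoints H l) (hv' : ∀ u ∈ endpoints H l, ¬ Linked l u v) {u : V}
    (hu : Linked l' u v) : Linked l u v := by
  induction h generalizing u with
  | refl => exact hu
  | @tail l₁ l₂ h₁ h₂ ih =>
    have hmem : Rotations H l l₂ := Relation.ReflTransGen.tail h₁ h₂
    obtain ⟨a, b, x, z, rfl, rfl, ha, hxz⟩ := h₂
    have hx : x ∈ endpoints H l := ⟨_, h₁, by simp [ha]⟩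
    rcases linked_append hu with h | h | ⟨h, h'⟩ | ⟨h, h'⟩
    · exact ih h.reverse.append_left
    · exact ih h.append_right
    -- Here `v = z`. Its old predecessor `w` heads the rotated list, so it is an endpoint; by
    -- induction it was already linked to `v` in `l`, which is excluded.
    · exfalso
      simp only [List.head?_cons, Option.some.injEq] at h'
      subst h'
      obtain ⟨a', rfl⟩ := List.head?_eq_some_iff.1 ha
      obtain ⟨w, hw⟩ : ∃ w, (x :: a').getLast? = some w :=
        ⟨_, List.getLast?_eq_some_getLast (List.cons_ne_nil _ _)⟩
      refine hv' w ⟨_, hmem, ?_⟩ (ih (linked_append_of_ends hw (by simp)))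
      rw [List.head?_append, List.head?_reverse, hw]; rfl
    -- Here `v` is the old head `x`, which is an endpoint.
    · exfalso
      rw [List.getLast?_reverse, ha] at h
      exact hv (by simpa using (Option.some.inj h) ▸ hx)

/-- **Pósa's lemma**: a neighbour of an endpoint is an endpoint or linked to one. -/
theorem exists_linked_of_adj {H : SimpleGraph V} {l : List V} {u v : V}
    (hu : u ∈ endpoints H l) (hvl : v ∈ l) (hv : v ∉ endpoints H l) (huv : H.Adj u v) :
    ∃ w ∈ endpoints H l, Linked l w v := by
  by_contra! hno
  obtain ⟨l', hl', hhead⟩ := hu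
  have hvl' : v ∈ l' := hl'.perm.mem_iff.2 hvl
  obtain ⟨a, b, rfl⟩ := List.append_of_mem hvl'
  cases a with
  | nil => exact hv ⟨_, hl', by simp⟩
  | cons x a =>
    obtain rfl : x = u := by simpa using hhead
    obtain ⟨w, hw⟩ : ∃ w, (x :: a).getLast? = some w :=
      ⟨_, List.getLast?_eq_some_getLast (List.cons_ne_nil _ _)⟩
    -- Rotating at `v` makes its predecessor `w` an endpoint; under the contrary assumption the
    -- links of `v` are still those of `l`.
    refine hno w ⟨(x :: a).reverse ++ v :: b, Relation.ReflTransGen.tail hl'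
      ⟨x :: a, b, x, v, rfl, rfl, rfl, huv⟩, ?_⟩
      (hl'.linked hv hno (linked_append_of_ends hw (by simp)))
    rw [List.head?_append, List.head?_reverse, hw]; rfl

end Rotations

/-! ### Expansion yields many boosters. -/

section Boosters

variable {V : Type*}

open Classical in
/-- The vertices of `U` outside `X` that have a neighbour in `X`. -/
noncomputable def outerNeighbours (H : SimpleGraph V) (U X : Finset V) : Finset V :=
  U.filter fun v => v ∉ X ∧ ∃ u ∈ X, H.Adj u v

theorem outerNeighbours_mono {H H' : SimpleGraph V} (h : H ≤ H') (U X : Finset V) :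
    outerNeighbours H U X ⊆ outerNeighbours H' U X := by
  classical
  intro v hv
  simp only [outerNeighbours, Finset.mem_filter] at hv ⊢
  obtain ⟨h1, h2, u, hu, huv⟩ := hv
  exact ⟨h1, h2, u, hu, h huv⟩

/-- Every non-empty set of at most `s` vertices of `U` has more than twice as many outer
neighbours in `U`. -/
def Expands (H : SimpleGraph V) (U : Finset V) (s : ℕ) : Prop :=
  ∀ X ⊆ U, X.Nonempty → X.card ≤ s → 2 * X.card < (outerNeighbours H U X).card

theorem Expands.mono {H H' : SimpleGraph V} {U : Finset V} {s : ℕ} (hH : Expands H U s)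
    (h : H ≤ H') : Expands H' U s := fun X hX hne hs =>
  (hH X hX hne hs).trans_le (Finset.card_le_card (outerNeighbours_mono h U X))

-- By Pósa's lemma every outer neighbour of the endpoint set is linked to an endpoint, so there are
-- at most twice as many of them as endpoints; expansion forbids this for sets of size at most `s`.
open Classical in
theorem Expands.lt_card_endpoints {H : SimpleGraph V} {U : Finset V} {s : ℕ} (hH : Expands H U s)
    {l : List V} (hl : l.Nodup) (hlU : ∀ v, v ∈ l ↔ v ∈ U) (hne : l ≠ []) :
    s < (U.filter (· ∈ endpoints H l)).card := by
  by_contra! hs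
  obtain ⟨x, l', rfl⟩ := List.exists_cons_of_ne_nil hne
  have hx : x ∈ U.filter (· ∈ endpoints H (x :: l')) :=
    Finset.mem_filter.2 ⟨(hlU x).1 (by simp), _, Relation.ReflTransGen.refl, rfl⟩
  have h1 := hH _ (Finset.filter_subset _ _) ⟨x, hx⟩ hs
  have h2 := card_linked_le hl (U.filter (· ∈ endpoints H (x :: l')))
    (outerNeighbours H U (U.filter (· ∈ endpoints H (x :: l')))) (by
      intro v hv
      simp only [outerNeighbours, Finset.mem_filter, not_and] at hv
      obtain ⟨hvU, hv, u, ⟨-, hu⟩, huv⟩ := hv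
      obtain ⟨w, hw, hwv⟩ := exists_linked_of_adj hu ((hlU v).2 hvU) (hv hvU) huv
      refine ⟨w, Finset.mem_filter.2 ⟨(hlU w).1 ?_, hw⟩, hwv⟩
      rcases hwv with h | h
      · exact h.subset (by simp)
      · exact h.subset (by simp))
  omega

/-- The vertices of `U` can be listed so that at least `k` consecutive pairs are edges of `H`. -/
def HasOrder (H : SimpleGraph V) (U : Finset V) (k : ℕ) : Prop :=
  ∃ l : List V, l.Nodup ∧ (∀ v, v ∈ l ↔ v ∈ U) ∧ k ≤ realLinks H l

theorem HasOrder.mono {H H' : SimpleGraph V} {U : Finset V} {k : ℕ} (hH : HasOrder H U k)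
    (h : H ≤ H') : HasOrder H' U k := by
  obtain ⟨l, h1, h2, h3⟩ := hH
  exact ⟨l, h1, h2, h3.trans (realLinks_mono h l)⟩

theorem hasOrder_zero (H : SimpleGraph V) (U : Finset V) : HasOrder H U 0 :=
  ⟨U.toList, U.nodup_toList, by simp, Nat.zero_le _⟩

theorem length_eq_card {U : Finset V} {l : List V} (hl : l.Nodup) (hlU : ∀ v, v ∈ l ↔ v ∈ U) :
    l.length = U.card := by
  classical
  rw [← List.toFinset_card_of_nodup hl]
  congr 1
  ext v
  simp [hlU]

/-- An edge that closes a listing to a cycle lets us cut it elsewhere and gain an edge. -/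
theorem hasOrder_succ_of_adj {H : SimpleGraph V} {U : Finset V} {k : ℕ} {l : List V}
    (hl : l.Nodup) (hlU : ∀ v, v ∈ l ↔ v ∈ U) (hk : k ≤ realLinks H l) (hkU : k + 1 < U.card)
    {x y : V} (hx : l.head? = some x) (hy : l.getLast? = some y) (hxy : H.Adj y x) :
    HasOrder H U (k + 1) := by
  classical
  rcases isChain_or_exists_not_adj H l with h | ⟨a, b, u, v, rfl, huv⟩
  · refine ⟨l, hl, hlU, ?_⟩
    rw [realLinks_of_isChain H h, length_eq_card hl hlU]
    omega
  -- The listing is read cyclically and cut at the non-adjacent pair `u`, `v`: no edge is lost, and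
  -- the closing edge `yx` is gained.
  · have hperm : (v :: b ++ (a ++ [u])).Perm (a ++ u :: v :: b) := by
      have : a ++ u :: v :: b = (a ++ [u]) ++ (v :: b) := by simp
      rw [this]
      exact List.perm_append_comm
    refine ⟨v :: b ++ (a ++ [u]), hperm.nodup_iff.2 hl, fun w => by rw [hperm.mem_iff, hlU], ?_⟩
    rw [realLinks_append, if_neg huv] at hk
    obtain ⟨a', ha'⟩ : ∃ a', a ++ [u] = x :: a' := by
      cases a with
      | nil => exact ⟨[], by simpa using hx⟩
      | cons z a => exact ⟨a ++ [u], by simpa using hx⟩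
    obtain ⟨b', hb'⟩ : ∃ b', v :: b = b' ++ [y] := by
      rw [List.getLast?_append, List.getLast?_cons_cons,
        List.getLast?_eq_some_getLast (List.cons_ne_nil v b)] at hy
      simp only [Option.some_or, Option.some.injEq] at hy
      refine ⟨(v :: b).dropLast, ?_⟩
      rw [← hy]
      exact (List.dropLast_append_getLast (List.cons_ne_nil v b)).symm
    rw [ha', hb'] at hk ⊢
    have : b' ++ [y] ++ x :: a' = b' ++ y :: x :: a' := by simp
    rw [this, realLinks_append, if_pos hxy]
    omega

/-- If `H` expands on `U` and the best listing of `U` is not yet a path, then there are many pairs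
whose addition improves it. -/
theorem Expands.exists_boosters [DecidableEq V] {H : SimpleGraph V} {U : Finset V} {s k : ℕ}
    (hH : Expands H U s) (hk : HasOrder H U k) (hkU : k + 1 < U.card) :
    ∃ B : Finset (Sym2 V), s * s ≤ 2 * B.card ∧
      ∀ e ∈ B, ¬ e.IsDiag ∧ ∀ H' : SimpleGraph V, H ≤ H' → e ∈ H'.edgeSet →
        HasOrder H' U (k + 1) := by
  classical
  obtain ⟨l, hl, hlU, hlk⟩ := hk
  have hcard := length_eq_card hl hlU
  have hne : l ≠ [] := by rintro rfl; simp at hcard; omega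
  set S := U.filter (· ∈ endpoints H l) with hS
  have hSs : s < S.card := hH.lt_card_endpoints hl hlU hne
  have hex : ∀ x ∈ S, ∃ l', Rotations H l l' ∧ l'.head? = some x :=
    fun x hx => (Finset.mem_filter.1 hx).2
  choose! L hL hLx using hex
  -- Reversal puts `x` at the end, where rotations leave it fixed; each `t ∈ T x` thus starts a
  -- listing that ends in `x`, and the pair `xt` closes it.
  let T : V → Finset V := fun x => U.filter (· ∈ endpoints H (L x).reverse)
  have hnodup : ∀ x ∈ S, (L x).reverse.Nodup := fun x hx =>
    List.nodup_reverse.2 ((hL x hx).perm.nodup_iff.2 hl)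
  have hmem : ∀ x ∈ S, ∀ v, v ∈ (L x).reverse ↔ v ∈ U := fun x hx v => by
    rw [List.mem_reverse, (hL x hx).perm.mem_iff, hlU]
  have hTs : ∀ x ∈ S, s < (T x).card := by
    intro x hx
    refine hH.lt_card_endpoints (hnodup x hx) (hmem x hx) ?_
    intro h
    have := hLx x hx
    rw [List.reverse_eq_nil_iff.1 h] at this
    simp at this
  have hgood : ∀ x ∈ S, ∀ t ∈ T x, x ≠ t ∧ ∀ H' : SimpleGraph V, H ≤ H' → H'.Adj x t →
      HasOrder H' U (k + 1) := by
    intro x hx t ht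
    obtain ⟨l', hl', ht⟩ := (Finset.mem_filter.1 ht).2
    have hnd : l'.Nodup := hl'.perm.nodup_iff.2 (hnodup x hx)
    have hm : ∀ v, v ∈ l' ↔ v ∈ U := fun v => by rw [hl'.perm.mem_iff, hmem x hx]
    have hlast : l'.getLast? = some x := by
      rw [hl'.getLast?, List.getLast?_reverse, hLx x hx]
    constructor
    · rintro rfl
      have hc := length_eq_card hnd hm
      obtain ⟨l'', rfl⟩ := List.head?_eq_some_iff.1 ht
      cases l'' with
      | nil => simp at hc; omega
      | cons y l'' =>
        rw [List.getLast?_cons_cons] at hlast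
        exact (List.nodup_cons.1 hnd).1 (List.mem_of_getLast? hlast)
    · intro H' hHH' hadj
      refine hasOrder_succ_of_adj hnd hm ?_ hkU ht hlast hadj
      calc k ≤ realLinks H l := hlk
        _ ≤ realLinks H (L x) := (hL x hx).realLinks_le
        _ = realLinks H (L x).reverse := (realLinks_reverse H _).symm
        _ ≤ realLinks H l' := hl'.realLinks_le
        _ ≤ realLinks H' l' := realLinks_mono hHH' _
  let D : Finset (Σ _ : V, V) := S.sigma T
  have hD : s * s ≤ D.card := by
    rw [Finset.card_sigma]
    calc s * s ≤ S.card * s := Nat.mul_le_mul_right _ hSs.le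
      _ = ∑ _ ∈ S, s := by simp
      _ ≤ ∑ x ∈ S, (T x).card := Finset.sum_le_sum fun x hx => (hTs x hx).le
  refine ⟨D.image fun d => s(d.1, d.2), ?_, ?_⟩
  · refine hD.trans (Finset.card_le_mul_card_image D 2 ?_)
    intro e he
    induction e with
    | h u v =>
      have hsub : {d ∈ D | s(d.1, d.2) = s(u, v)} ⊆ {⟨u, v⟩, ⟨v, u⟩} := by
        rintro ⟨x, y⟩ h
        have := (Finset.mem_filter.1 h).2
        simp only [Sym2.eq_iff] at this
        rcases this with ⟨rfl, rfl⟩ | ⟨rfl, rfl⟩ <;> simp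
      exact (Finset.card_le_card hsub).trans Finset.card_le_two
  · intro e he
    obtain ⟨⟨x, t⟩, hd, rfl⟩ := Finset.mem_image.1 he
    obtain ⟨hx, ht⟩ := Finset.mem_sigma.1 hd
    obtain ⟨h1, h2⟩ := hgood x hx t ht
    exact ⟨by simpa using h1, fun H' hle hadj => h2 H' hle (by simpa using hadj)⟩

open Classical in
/-- The pairs of distinct vertices whose addition to `H` improves the best listing of `U`. -/
noncomputable def boosters [Fintype V] (H : SimpleGraph V) (U : Finset V) : Finset (Sym2 V) :=
  Finset.univ.filter fun e => ¬ e.IsDiag ∧ ∃ k, ¬ HasOrder H U k ∧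
    ∀ H' : SimpleGraph V, H ≤ H' → e ∈ H'.edgeSet → HasOrder H' U k

theorem mem_boosters [Fintype V] {H : SimpleGraph V} {U : Finset V} {e : Sym2 V} :
    e ∈ boosters H U ↔ ¬ e.IsDiag ∧ ∃ k, ¬ HasOrder H U k ∧
      ∀ H' : SimpleGraph V, H ≤ H' → e ∈ H'.edgeSet → HasOrder H' U k := by
  simp [boosters]

/-- This makes the boosters of `S ∪ F` disjoint from the pairs of `F`, so that containing `F` and
missing the boosters are independent events for `T`. -/
theorem notMem_edgeSet_of_mem_boosters [Fintype V] {H : SimpleGraph V} {U : Finset V} {e : Sym2 V}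
    (he : e ∈ boosters H U) : e ∉ H.edgeSet := by
  obtain ⟨-, k, hk, h⟩ := mem_boosters.1 he
  exact fun h' => hk (h H le_rfl h')

theorem Expands.le_card_boosters [Fintype V] {H : SimpleGraph V} {U : Finset V} {s k : ℕ}
    (hH : Expands H U s) (hk : HasOrder H U k) (hk' : ¬ HasOrder H U (k + 1))
    (hkU : k + 1 < U.card) : s * s ≤ 2 * (boosters H U).card := by
  classical
  obtain ⟨B, hB, h⟩ := hH.exists_boosters hk hkU
  refine hB.trans (Nat.mul_le_mul_left _ (Finset.card_le_card fun e he => ?_))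
  exact mem_boosters.2 ⟨(h e he).1, k + 1, hk', (h e he).2⟩

/-- If the graph `S` expands on `U`, then the edges of `T` either complete it to a graph with a
path through `U`, or they miss all boosters of `S ∪ F` for a small subset `F` of `T`. -/
theorem Expands.hasOrder_or_stuck [Fintype V] [DecidableEq V] {S T : Finset (Sym2 V)}
    {U : Finset V} {s : ℕ} (hS : Expands (SimpleGraph.fromEdgeSet (S : Set (Sym2 V))) U s) :
    HasOrder (SimpleGraph.fromEdgeSet ((S ∪ T : Finset (Sym2 V)) : Set (Sym2 V))) U (U.card - 1) ∨
    ∃ F ⊆ T, F.card ≤ U.card ∧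
      s * s ≤ 2 * (boosters (SimpleGraph.fromEdgeSet ((S ∪ F : Finset (Sym2 V)) : Set (Sym2 V)))
        U).card ∧
      Disjoint (boosters (SimpleGraph.fromEdgeSet ((S ∪ F : Finset (Sym2 V)) : Set (Sym2 V))) U)
        T := by
  by_contra! hno
  obtain ⟨hno1, hno2⟩ := hno
  have key : ∀ k < U.card, ∃ F ⊆ T, F.card ≤ k ∧
      HasOrder (SimpleGraph.fromEdgeSet ((S ∪ F : Finset (Sym2 V)) : Set (Sym2 V))) U k := by
    intro k
    induction k with
    | zero => exact fun _ => ⟨∅, by simp, by simp, hasOrder_zero _ _⟩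
    | succ k ih =>
      intro hk
      obtain ⟨F, hFT, hFk, hF⟩ := ih (by omega)
      by_cases hF' : HasOrder
          (SimpleGraph.fromEdgeSet ((S ∪ F : Finset (Sym2 V)) : Set (Sym2 V))) U (k + 1)
      · exact ⟨F, hFT, by omega, hF'⟩
      have hexp : Expands (SimpleGraph.fromEdgeSet ((S ∪ F : Finset (Sym2 V)) : Set (Sym2 V))) U s :=
        hS.mono (SimpleGraph.fromEdgeSet_mono (by simp))
      have hcard := hexp.le_card_boosters hF hF' hk
      obtain ⟨e, he, heT⟩ := Finset.not_disjoint_iff.1 (hno2 F hFT (by omega) hcard)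
      obtain ⟨hdiag, k', hk', h⟩ := mem_boosters.1 he
      -- The level `k` is already attained by `S ∪ F`, so the unattained level `k'` lies above it.
      have hk'' : k + 1 ≤ k' := by
        by_contra! hlt
        obtain ⟨l, h1, h2, h3⟩ := hF
        exact hk' ⟨l, h1, h2, by omega⟩
      refine ⟨insert e F, Finset.insert_subset heT hFT,
        (Finset.card_insert_le _ _).trans (by omega), ?_⟩
      obtain ⟨l, h1, h2, h3⟩ := h
        (SimpleGraph.fromEdgeSet ((S ∪ insert e F : Finset (Sym2 V)) : Set (Sym2 V)))
        (SimpleGraph.fromEdgeSet_mono (by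
          exact_mod_cast Finset.union_subset_union_right (Finset.subset_insert _ _)))
        (by simpa using hdiag)
      exact ⟨l, h1, h2, hk''.trans h3⟩
  rcases Nat.eq_zero_or_pos U.card with h0 | hpos
  · exact hno1 (by rw [h0]; exact hasOrder_zero _ _)
  obtain ⟨F, hFT, -, hF⟩ := key (U.card - 1) (by omega)
  refine hno1 (hF.mono (SimpleGraph.fromEdgeSet_mono ?_))
  exact_mod_cast Finset.union_subset_union_right hFT

end Boosters

/-! ### From a colouring with few colours to a stuck configuration. -/

section Deterministic

variable {V : Type*}

/-- Any two disjoint sets of `s` vertices are joined by an edge. -/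
def Joined (H : SimpleGraph V) (s : ℕ) : Prop :=
  ∀ A B : Finset V, Disjoint A B → A.card = s → B.card = s → ∃ a ∈ A, ∃ b ∈ B, H.Adj a b

/-- A colouring with few colours admits an involution that preserves the colours and moves
a prescribed number of vertices, up to parity. -/
theorem exists_involution [Fintype V] [DecidableEq V] {k : ℕ} (φ : V → Fin k) (m : ℕ)
    (hm : m + k ≤ Fintype.card V) :
    ∃ τ : Equiv.Perm V, τ * τ = 1 ∧ (∀ v, φ (τ v) = φ v) ∧ τ.support.card ≤ m ∧
      m ≤ τ.support.card + 1 := by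
  induction m with
  | zero => exact ⟨1, by simp, by simp, by simp, by simp⟩
  | succ m ih =>
    obtain ⟨τ, h1, h2, h3, h4⟩ := ih (by omega)
    by_cases h5 : m + 1 ≤ τ.support.card + 1
    · exact ⟨τ, h1, h2, by omega, h5⟩
    -- In this case the support has exactly `m - 1` elements. More than `k` points are fixed, so two
    -- of them share a colour and can be swapped.
    have h6 : (Finset.univ : Finset (Fin k)).card < τ.supportᶜ.card := by
      rw [Finset.card_compl, Finset.card_fin]
      omega
    obtain ⟨x, hx, y, hy, hxy, hφ⟩ :=
      Finset.exists_ne_map_eq_of_card_lt_of_maps_to h6 (f := φ) (fun _ _ => Finset.mem_coe.2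
        (Finset.mem_univ _))
    have hx' : τ x = x := by simpa using hx
    have hy' : τ y = y := by simpa using hy
    have hd : τ.Disjoint (Equiv.swap x y) := by
      intro v
      by_cases hvx : v = x
      · exact Or.inl (hvx ▸ hx')
      by_cases hvy : v = y
      · exact Or.inl (hvy ▸ hy')
      · exact Or.inr (Equiv.swap_apply_of_ne_of_ne hvx hvy)
    have hc := hd.card_support_mul
    rw [Equiv.Perm.card_support_swap hxy] at hc
    refine ⟨τ * Equiv.swap x y, ?_, ?_, by omega, by omega⟩
    · rw [hd.commute.symm.mul_mul_mul_comm, h1, Equiv.swap_mul_self, one_mul]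
    · intro v
      rw [Equiv.Perm.mul_apply, h2]
      by_cases hvx : v = x
      · rw [hvx, Equiv.swap_apply_left, hφ]
      by_cases hvy : v = y
      · rw [hvy, Equiv.swap_apply_right, hφ]
      · rw [Equiv.swap_apply_of_ne_of_ne hvx hvy]

/-- In a graph without large holes, the support of an involution contains an invariant set on
which the graph expands. -/
theorem Joined.exists_expands [Fintype V] [DecidableEq V] {H : SimpleGraph V} {s : ℕ}
    (hH : Joined H s) (hs : 0 < s) {τ : Equiv.Perm V} (hτ : τ * τ = 1)
    (hcard : 9 * s ≤ τ.support.card) :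
    ∃ U ⊆ τ.support, (∀ v ∈ U, τ v ∈ U) ∧ U.Nonempty ∧ Expands H U s := by
  classical
  have hinv : ∀ v, τ (τ v) = v := fun v => by rw [← Equiv.Perm.mul_apply, hτ]; rfl
  -- Neighbours of `Z` count only if they survive the deletion of both `Z` and its `τ`-image, so
  -- that the remaining set is invariant.
  let D : Finset V → Finset V := fun Z =>
    τ.support.filter fun v => v ∉ Z ∧ τ v ∉ Z ∧ ∃ u ∈ Z, H.Adj u v
  obtain ⟨Z, hZ, hmax⟩ := Finset.exists_max_image
    (τ.support.powerset.filter fun Z => Z.card < s ∧ (D Z).card ≤ 2 * Z.card) Finset.card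
    ⟨∅, by simp [D, hs]⟩
  simp only [Finset.mem_filter, Finset.mem_powerset] at hZ hmax
  obtain ⟨hZW, hZs, hDZ⟩ := hZ
  have hτcard : ∀ X : Finset V, (X.image τ).card = X.card := fun X =>
    Finset.card_image_of_injective _ τ.injective
  have hmemτ : ∀ (X : Finset V) v, v ∈ X.image τ ↔ τ v ∈ X := by
    intro X v
    rw [Finset.mem_image]
    constructor
    · rintro ⟨w, hw, rfl⟩
      rwa [hinv]
    · exact fun h => ⟨_, h, hinv v⟩
  let U := τ.support.filter fun v => v ∉ Z ∧ τ v ∉ Z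
  have hU : ∀ v, v ∈ U ↔ v ∈ τ.support ∧ v ∉ Z ∧ τ v ∉ Z := fun v => by simp [U]
  refine ⟨U, Finset.filter_subset _ _, ?_, ?_, ?_⟩
  · intro v hv
    rw [hU] at hv ⊢
    exact ⟨Equiv.Perm.apply_mem_support.2 hv.1, hv.2.2, by rw [hinv]; exact hv.2.1⟩
  · rw [← Finset.card_pos]
    have hsub : τ.support ⊆ U ∪ (Z ∪ Z.image τ) := by
      intro v hv
      simp only [Finset.mem_union, hU, hmemτ]
      tauto
    have h1 := Finset.card_le_card hsub
    have h2 := Finset.card_union_le U (Z ∪ Z.image τ)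
    have h3 := Finset.card_union_le Z (Z.image τ)
    rw [hτcard] at h3
    omega
  · intro X hXU hX hXs
    by_contra! hbad
    have hdisj : Disjoint Z X := Finset.disjoint_left.2 fun v hv hvX => ((hU v).1 (hXU hvX)).2.1 hv
    have hc : (Z ∪ X).card = Z.card + X.card := Finset.card_union_of_disjoint hdisj
    have hXW : X ⊆ τ.support := hXU.trans (Finset.filter_subset _ _)
    -- A non-expanding `X` could be added to `Z` without violating the bound on `D`, so maximality
    -- forces `Z ∪ X` to have at least `s` elements.
    have hD : D (Z ∪ X) ⊆ D Z ∪ outerNeighbours H U X := by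
      intro v hv
      simp only [D, outerNeighbours, Finset.mem_filter, Finset.mem_union, hU, not_or] at hv ⊢
      obtain ⟨h1, ⟨h2, h3⟩, ⟨h4, h5⟩, u, hu | hu, huv⟩ := hv
      · exact Or.inl ⟨h1, h2, h4, u, hu, huv⟩
      · exact Or.inr ⟨⟨h1, h2, h4⟩, h3, u, hu, huv⟩
    have hDc : (D (Z ∪ X)).card ≤ 2 * (Z ∪ X).card := by
      have := (Finset.card_le_card hD).trans (Finset.card_union_le _ _)
      omega
    have hXpos := hX.card_pos
    have hlarge : s ≤ (Z ∪ X).card := by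
      by_contra! hlt
      have := hmax (Z ∪ X) ⟨Finset.union_subset hZW hXW, hlt, hDc⟩
      omega
    let Y := Z ∪ X
    let R := τ.support.filter fun v => v ∉ Y ∧ τ v ∉ Y ∧ ∀ u ∈ Y, ¬ H.Adj u v
    -- As `Y` has fewer than `2 * s` elements, `Y`, its image and `D Y` cover fewer than `8 * s`
    -- elements of the support. This is the origin of the 9: at least `s` vertices remain without a
    -- neighbour in `Y`, a hole.
    have hR : s ≤ R.card := by
      have hsub : τ.support ⊆ R ∪ (D Y ∪ (Y ∪ Y.image τ)) := by
        intro v hv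
        simp only [Finset.mem_union (s := R), Finset.mem_union (s := D Y),
          Finset.mem_union (s := Y), hmemτ, R, D, Finset.mem_filter, hv, true_and]
        by_cases h1 : v ∈ Y
        · tauto
        by_cases h2 : τ v ∈ Y
        · tauto
        by_cases h3 : ∃ u ∈ Y, H.Adj u v
        · exact Or.inr (Or.inl ⟨h1, h2, h3⟩)
        · exact Or.inl ⟨h1, h2, fun u hu huv => h3 ⟨u, hu, huv⟩⟩
      have h1 := Finset.card_le_card hsub
      have h2 := Finset.card_union_le R (D Y ∪ (Y ∪ Y.image τ))
      have h3 := Finset.card_union_le (D Y) (Y ∪ Y.image τ)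
      have h4 := Finset.card_union_le Y (Y.image τ)
      rw [hτcard] at h4
      have h5 : Y.card = Z.card + X.card := hc
      have h6 : (D Y).card ≤ 2 * Y.card := hDc
      omega
    obtain ⟨A, hA, hAs⟩ := Finset.exists_subset_card_eq hlarge
    obtain ⟨B, hB, hBs⟩ := Finset.exists_subset_card_eq hR
    obtain ⟨a, ha, b, hb, hab⟩ := hH A B (Finset.disjoint_left.2 fun v hvA hvB =>
      (Finset.mem_filter.1 (hB hvB)).2.1 (hA hvA)) hAs hBs
    exact (Finset.mem_filter.1 (hB hb)).2.2.2 a (hA ha) hab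

/-- A path through a set that contains with each vertex another one of the same colour has
no centre. -/
theorem not_isLinear_of_hasOrder {α : Type*} {H : SimpleGraph V} {U : Finset V}
    (hU : HasOrder H U (U.card - 1)) (hne : U.Nonempty) (φ : V → α)
    (hφ : ∀ v ∈ U, ∃ w ∈ U, w ≠ v ∧ φ w = φ v) : ¬ IsLinear H φ := by
  intro hlin
  obtain ⟨l, hl, hlU, hk⟩ := hU
  rw [← length_eq_card hl hlU] at hk
  have hchain := isChain_of_le_realLinks H hk
  have hnil : l ≠ [] := by
    rintro rfl
    obtain ⟨v, hv⟩ := hne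
    simpa using (hlU v).2 hv
  have hsupp := SimpleGraph.Walk.support_ofSupport hnil hchain
  obtain ⟨v, hv, hvc⟩ := hlin _ _ (SimpleGraph.Walk.ofSupport l hnil hchain)
    (by rw [SimpleGraph.Walk.isPath_def, hsupp]; exact hl)
  simp only [hsupp, Set.mem_ofPred_eq] at hv hvc
  obtain ⟨w, hw, hwv, he⟩ := hφ v ((hlU v).1 hv)
  exact hvc w ((hlU w).2 hw) hwv he.symm

/-- If the union of two graphs `S` and `T`, where `S` has no large holes, has a linear colouring
with few colours, then `T` misses all boosters of some `S ∪ F`. -/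
theorem Joined.exists_stuck [Fintype V] [DecidableEq V] {S T : Finset (Sym2 V)} {s m k : ℕ}
    (hS : Joined (SimpleGraph.fromEdgeSet (S : Set (Sym2 V))) s) (hs : 0 < s)
    (hsm : 9 * s + 1 ≤ m) (hmk : m + k ≤ Fintype.card V) (φ : V → Fin k)
    (hφ : IsLinear (SimpleGraph.fromEdgeSet ((S ∪ T : Finset (Sym2 V)) : Set (Sym2 V))) φ) :
    ∃ (U : Finset V), ∃ F ⊆ T, F.card ≤ m ∧
      s * s ≤ 2 * (boosters (SimpleGraph.fromEdgeSet ((S ∪ F : Finset (Sym2 V)) : Set (Sym2 V)))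
        U).card ∧
      Disjoint (boosters (SimpleGraph.fromEdgeSet ((S ∪ F : Finset (Sym2 V)) : Set (Sym2 V))) U)
        T := by
  obtain ⟨τ, h1, h2, h3, h4⟩ := exists_involution φ m hmk
  obtain ⟨U, hUτ, hUinv, hne, hexp⟩ := hS.exists_expands hs h1 (by omega)
  rcases hexp.hasOrder_or_stuck (T := T) with h | ⟨F, hFT, hF, hB, hd⟩
  · refine absurd hφ (not_isLinear_of_hasOrder h hne φ fun v hv => ⟨τ v, hUinv v hv, ?_, h2 v⟩)
    exact Equiv.Perm.mem_support.1 (hUτ hv)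
  · exact ⟨U, F, hFT, hF.trans ((Finset.card_le_card hUτ).trans h3), hB, hd⟩

end Deterministic

/-! ### Union bounds for the two rounds of exposure. -/

section UnionBound

variable {V : Type*} [Fintype V] [DecidableEq V]

/-- The pairs of a vertex of `A` and a vertex of `B`. -/
def crossPairs (A B : Finset V) : Finset (Sym2 V) :=
  (A ×ˢ B).image fun x => s(x.1, x.2)

omit [Fintype V] in
theorem card_crossPairs {A B : Finset V} (h : Disjoint A B) :
    (crossPairs A B).card = A.card * B.card := by
  rw [crossPairs, Finset.card_image_of_injOn, Finset.card_product]
  rintro ⟨a, b⟩ hx ⟨c, d⟩ hy hxy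
  simp only [Finset.coe_product, Set.mem_prod, Finset.mem_coe] at hx hy
  rcases Sym2.eq_iff.1 hxy with ⟨h1, h2⟩ | ⟨h1, h2⟩
  · exact Prod.ext h1 h2
  · simp only at h1
    exact absurd hy.2 (Finset.disjoint_left.1 h (h1 ▸ hx.1))

theorem crossPairs_subset_allPairs {A B : Finset V} (h : Disjoint A B) :
    crossPairs A B ⊆ allPairs V := by
  intro e he
  obtain ⟨⟨a, b⟩, hx, rfl⟩ := Finset.mem_image.1 he
  obtain ⟨ha, hb⟩ := Finset.mem_product.1 hx
  refine Finset.mem_filter.2 ⟨Finset.mem_univ _, ?_⟩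
  simp only [Sym2.mk_isDiag_iff]
  rintro rfl
  exact Finset.disjoint_left.1 h ha hb

omit [Fintype V] in
theorem exists_of_not_joined {S : Finset (Sym2 V)} {s : ℕ}
    (h : ¬ Joined (SimpleGraph.fromEdgeSet (S : Set (Sym2 V))) s) :
    ∃ A B : Finset V, Disjoint A B ∧ A.card = s ∧ B.card = s ∧ Disjoint (crossPairs A B) S := by
  unfold Joined at h
  push Not at h
  obtain ⟨A, B, hAB, hA, hB, h⟩ := h
  refine ⟨A, B, hAB, hA, hB, Finset.disjoint_left.2 fun e he heS => ?_⟩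
  obtain ⟨⟨a, b⟩, hx, rfl⟩ := Finset.mem_image.1 he
  obtain ⟨ha, hb⟩ := Finset.mem_product.1 hx
  refine h a ha b hb ?_
  rw [SimpleGraph.fromEdgeSet_adj]
  exact ⟨heS, fun hab => Finset.disjoint_left.1 hAB ha (by rw [hab]; exact hb)⟩

theorem one_sub_pow_le_exp {q : ℝ} (h1 : q ≤ 1) (k : ℕ) : (1 - q) ^ k ≤ Real.exp (-(q * k)) := by
  rw [show -(q * k) = k * (-q) by ring, Real.exp_nat_mul]
  have := Real.one_sub_le_exp_neg q
  gcongr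

/-- A random graph is unlikely to have a large hole. -/
theorem subsetExpect_not_joined_le {q : ℝ} (h1 : q ≤ 1) (s : ℕ) :
    subsetExpect q (allPairs V) (fun S => ∑ P : Finset V × Finset V,
      if Disjoint P.1 P.2 ∧ P.1.card = s ∧ P.2.card = s ∧ Disjoint (crossPairs P.1 P.2) S
        then 1 else 0) ≤ 4 ^ Fintype.card V * Real.exp (-(q * s ^ 2)) := by
  rw [subsetExpect_sum]
  calc _ ≤ ∑ P : Finset V × Finset V, Real.exp (-(q * s ^ 2)) := by
        refine Finset.sum_le_sum fun P _ => ?_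
        by_cases hP : Disjoint P.1 P.2 ∧ P.1.card = s ∧ P.2.card = s
        · obtain ⟨hd, hA, hB⟩ := hP
          have h := subsetExpect_cylinder q (Finset.empty_subset (allPairs V))
            (crossPairs_subset_allPairs hd) (Finset.disjoint_empty_left _)
          simp only [Finset.empty_subset, true_and, Finset.card_empty, pow_zero, one_mul] at h
          simp only [hd, hA, hB, true_and]
          rw [h, card_crossPairs hd, hA, hB]
          refine (one_sub_pow_le_exp h1 _).trans_eq ?_
          push_cast
          ring_nf
        · have h2 : ∀ S : Finset (Sym2 V), ¬ (Disjoint P.1 P.2 ∧ P.1.card = s ∧ P.2.card = s ∧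
              Disjoint (crossPairs P.1 P.2) S) := fun S h => hP ⟨h.1, h.2.1, h.2.2.1⟩
          simp only [h2, if_false, subsetExpect_const]
          positivity
    _ = 4 ^ Fintype.card V * Real.exp (-(q * s ^ 2)) := by
        rw [Finset.sum_const, Finset.card_univ, Fintype.card_prod, Fintype.card_finset, nsmul_eq_mul]
        push_cast
        rw [← mul_pow]
        norm_num

/-- It is unlikely that the second round of exposure misses all boosters. -/
theorem subsetExpect_stuck_le {q w : ℝ} (h0 : 0 ≤ q) (h1 : q ≤ 1) (hw : 1 ≤ w) (s m : ℕ)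
    (β : Finset V → Finset (Sym2 V) → Finset (Sym2 V)) (hβ : ∀ U F, β U F ⊆ allPairs V)
    (hβF : ∀ U, ∀ F ⊆ allPairs V, Disjoint F (β U F)) :
    subsetExpect q (allPairs V) (fun T => ∑ U : Finset V,
      ∑ F ∈ (allPairs V).powerset with F.card ≤ m,
        if s * s ≤ 2 * (β U F).card ∧ F ⊆ T ∧ Disjoint (β U F) T then 1 else 0) ≤
      2 ^ Fintype.card V * (w ^ m * Real.exp (q / w * (Fintype.card V).choose 2)) *
        Real.exp (-(q * s ^ 2 / 2)) := by
  rw [subsetExpect_sum]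
  calc _ ≤ ∑ U : Finset V, ∑ F ∈ (allPairs V).powerset with F.card ≤ m,
          q ^ F.card * Real.exp (-(q * s ^ 2 / 2)) := by
        refine Finset.sum_le_sum fun U _ => ?_
        rw [subsetExpect_sum]
        refine Finset.sum_le_sum fun F hF => ?_
        have hFE := Finset.mem_powerset.1 (Finset.mem_filter.1 hF).1
        by_cases hs : s * s ≤ 2 * (β U F).card
        · simp only [hs, true_and]
          rw [subsetExpect_cylinder q hFE (hβ U F) (hβF U F hFE)]
          gcongr
          refine (one_sub_pow_le_exp h1 _).trans ?_
          rw [Real.exp_le_exp, neg_le_neg_iff, mul_div_assoc]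
          have : (s : ℝ) * s ≤ 2 * (β U F).card := by exact_mod_cast hs
          gcongr
          linarith
        · simp only [hs, false_and, if_false, subsetExpect_const]
          positivity
    _ = 2 ^ Fintype.card V * (∑ F ∈ (allPairs V).powerset with F.card ≤ m, q ^ F.card) *
          Real.exp (-(q * s ^ 2 / 2)) := by
        rw [Finset.sum_const, Finset.card_univ, Fintype.card_finset, nsmul_eq_mul,
          ← Finset.sum_mul]
        push_cast
        ring
    _ ≤ _ := by
        have := sum_pow_card_le h0 hw (allPairs V) m
        rw [card_allPairs] at this
        gcongr

/-- The probability that the linear chromatic number of a random graph is at most `|V| - m`. -/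
theorem binomialRandom_linearChromaticNumber_le (p : unitInterval) {q w : ℝ} (h0 : 0 ≤ q)
    (h1 : q ≤ 1) (hpq : 1 - (p : ℝ) = (1 - q) ^ 2) (hw : 1 ≤ w) {s m : ℕ} (hs : 0 < s)
    (hsm : 9 * s + 1 ≤ m) :
    (SimpleGraph.binomialRandom V p).real
        {G | m + linearChromaticNumber G ≤ Fintype.card V} ≤
      4 ^ Fintype.card V * Real.exp (-(q * s ^ 2)) +
      2 ^ Fintype.card V * (w ^ m * Real.exp (q / w * (Fintype.card V).choose 2)) *
        Real.exp (-(q * s ^ 2 / 2)) := by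
  classical
  rw [binomialRandom_real_eq, subsetExpect_union hpq]
  set C := 2 ^ Fintype.card V * (w ^ m * Real.exp (q / w * (Fintype.card V).choose 2)) *
        Real.exp (-(q * s ^ 2 / 2)) with hC
  have hC0 : 0 ≤ C := by positivity
  -- For each outcome `S` of the first round, the conditional failure probability is at most 1 if
  -- `S` has a hole and at most `C` otherwise.
  refine le_trans (subsetExpect_mono h0 h1 (g := fun S => (∑ P : Finset V × Finset V,
      if Disjoint P.1 P.2 ∧ P.1.card = s ∧ P.2.card = s ∧ Disjoint (crossPairs P.1 P.2) S
        then 1 else 0) + C) ?_) ?_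
  · intro S _
    by_cases hS : Joined (SimpleGraph.fromEdgeSet (S : Set (Sym2 V))) s
    · refine le_trans ?_ (le_add_of_nonneg_left (Finset.sum_nonneg fun P _ => by split_ifs <;> simp))
      let β : Finset V → Finset (Sym2 V) → Finset (Sym2 V) := fun U F =>
        boosters (SimpleGraph.fromEdgeSet ((S ∪ F : Finset (Sym2 V)) : Set (Sym2 V))) U
      refine le_trans (subsetExpect_mono h0 h1 ?_) (subsetExpect_stuck_le h0 h1 hw s m β ?_ ?_)
      · intro T hT
        by_cases hQ : SimpleGraph.fromEdgeSet ((S ∪ T : Finset (Sym2 V)) : Set (Sym2 V)) ∈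
            {G : SimpleGraph V | m + linearChromaticNumber G ≤ Fintype.card V}
        · rw [if_pos hQ]
          obtain ⟨φ, hφ⟩ := exists_isLinear
            (SimpleGraph.fromEdgeSet ((S ∪ T : Finset (Sym2 V)) : Set (Sym2 V)))
          obtain ⟨U, F, hFT, hF, hB, hd⟩ := hS.exists_stuck hs hsm hQ φ hφ
          have hFm : F ∈ (allPairs V).powerset.filter fun F => F.card ≤ m :=
            Finset.mem_filter.2 ⟨Finset.mem_powerset.2 (hFT.trans hT), hF⟩
          calc (1 : ℝ) = if s * s ≤ 2 * (β U F).card ∧ F ⊆ T ∧ Disjoint (β U F) T then 1 else 0 :=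
                (if_pos ⟨hB, hFT, hd⟩).symm
            _ ≤ ∑ F ∈ (allPairs V).powerset with F.card ≤ m,
                  if s * s ≤ 2 * (β U F).card ∧ F ⊆ T ∧ Disjoint (β U F) T then 1 else 0 :=
                Finset.single_le_sum (f := fun F =>
                  if s * s ≤ 2 * (β U F).card ∧ F ⊆ T ∧ Disjoint (β U F) T then (1 : ℝ) else 0)
                  (fun F _ => by split_ifs <;> simp) hFm
            _ ≤ _ := Finset.single_le_sum (f := fun U =>
                ∑ F ∈ (allPairs V).powerset with F.card ≤ m,
                  if s * s ≤ 2 * (β U F).card ∧ F ⊆ T ∧ Disjoint (β U F) T then (1 : ℝ) else 0)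
                  (fun U _ => Finset.sum_nonneg fun F _ => by split_ifs <;> simp)
                  (Finset.mem_univ U)
        · rw [if_neg hQ]
          exact Finset.sum_nonneg fun U _ => Finset.sum_nonneg fun F _ => by split_ifs <;> simp
      · intro U F e he
        exact Finset.mem_filter.2 ⟨Finset.mem_univ _, (mem_boosters.1 he).1⟩
      · intro U F hF
        refine Finset.disjoint_left.2 fun e he heB => notMem_edgeSet_of_mem_boosters heB ?_
        rw [SimpleGraph.edgeSet_fromEdgeSet]
        exact ⟨by simp [he], (Finset.mem_filter.1 (hF he)).2⟩
    · obtain ⟨A, B, hAB, hA, hB, hd⟩ := exists_of_not_joined hS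
      calc _ ≤ subsetExpect q (allPairs V) (fun _ => 1) :=
            subsetExpect_mono h0 h1 fun T _ => by split_ifs <;> simp
        _ = 1 := subsetExpect_const _ _ _
        _ = if Disjoint A B ∧ A.card = s ∧ B.card = s ∧ Disjoint (crossPairs A B) S
              then 1 else 0 := (if_pos ⟨hAB, hA, hB, hd⟩).symm
        _ ≤ ∑ P : Finset V × Finset V,
              if Disjoint P.1 P.2 ∧ P.1.card = s ∧ P.2.card = s ∧ Disjoint (crossPairs P.1 P.2) S
                then 1 else 0 :=
            Finset.single_le_sum (f := fun P : Finset V × Finset V =>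
              if Disjoint P.1 P.2 ∧ P.1.card = s ∧ P.2.card = s ∧
                Disjoint (crossPairs P.1 P.2) S then (1 : ℝ) else 0)
              (fun P _ => by split_ifs <;> simp) (Finset.mem_univ (A, B))
        _ ≤ _ := le_add_of_nonneg_right hC0
  · rw [subsetExpect_add, subsetExpect_const]
    gcongr
    exact subsetExpect_not_joined_le h1 s

end UnionBound

/-! ### Comparison of the two chromatic numbers. -/

section ChromaticNumbers

variable {V : Type*}

theorem IsCentred.isLinear {α : Type*} {G : SimpleGraph V} {φ : V → α} (h : IsCentred G φ) :
    IsLinear G φ := by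
  intro a b P _
  obtain ⟨v, hv⟩ := h P.toSubgraph P.toSubgraph_connected
  rw [SimpleGraph.Walk.verts_toSubgraph] at hv
  exact ⟨v, hv⟩

theorem linearChromaticNumber_le_centredChromaticNumber [Finite V] (G : SimpleGraph V) :
    linearChromaticNumber G ≤ centredChromaticNumber G := by
  obtain ⟨φ, hφ⟩ := exists_isCentred G
  exact Nat.sInf_le ⟨φ, hφ.isLinear⟩

theorem centredChromaticNumber_le [Finite V] (G : SimpleGraph V) :
    centredChromaticNumber G ≤ Nat.card V := by
  refine Nat.sInf_le ⟨Finite.equivFin V, fun H hH => ?_⟩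
  obtain ⟨v, hv⟩ := hH.nonempty
  exact ⟨v, hv, fun w _ hwv h => hwv ((Finite.equivFin V).injective h).symm⟩

end ChromaticNumbers

/-! ### Choice of parameters and limits. -/

section Asymptotics

theorem AAS.mono {p : ℕ → unitInterval} {Q R : ∀ n : ℕ, SimpleGraph (Fin n) → Prop}
    (hQ : AAS p Q) (h : ∀ᶠ n in atTop, ∀ G, Q n G → R n G) : AAS p R := by
  refine tendsto_of_tendsto_of_tendsto_of_le_of_le' hQ tendsto_const_nhds ?_
    (Eventually.of_forall fun n => MeasureTheory.measureReal_le_one)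
  filter_upwards [h] with n hn
  exact MeasureTheory.measureReal_mono fun G hG => hn G hG

theorem aas_of_le {p : ℕ → unitInterval} {Q : ∀ n : ℕ, SimpleGraph (Fin n) → Prop}
    {ε : ℕ → ℝ} (hε : Tendsto ε atTop (𝓝 0))
    (h : ∀ᶠ n in atTop,
      (SimpleGraph.binomialRandom (Fin n) (p n)).real {G | ¬ Q n G} ≤ ε n) : AAS p Q := by
  have h1 : Tendsto (fun n => 1 - ε n) atTop (𝓝 1) := by simpa using hε.const_sub 1
  refine tendsto_of_tendsto_of_tendsto_of_le_of_le' h1 tendsto_const_nhds ?_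
    (Eventually.of_forall fun n => MeasureTheory.measureReal_le_one)
  filter_upwards [h] with n hn
  have h2 := MeasureTheory.measureReal_union_le
    (μ := SimpleGraph.binomialRandom (Fin n) (p n)) {G | Q n G} {G | ¬ Q n G}
  have h3 : {G | Q n G} ∪ {G | ¬ Q n G} = Set.univ := Set.eq_univ_of_forall fun G => em _
  rw [h3, MeasureTheory.probReal_univ] at h2
  linarith

/-- The lower bound on `q` makes the exponents `q s²` large; the upper bound controls the number of
choices of `F`. -/
theorem exists_two_round_parameter {p : ℝ} (h0 : 0 ≤ p) (h1 : p ≤ 1) :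
    ∃ q : ℝ, p / 2 ≤ q ∧ q ≤ p ∧ 1 - p = (1 - q) ^ 2 := by
  refine ⟨1 - √(1 - p), ?_, ?_, ?_⟩
  · have : √(1 - p) ≤ 1 - p / 2 := Real.sqrt_le_iff.2 ⟨by linarith, by nlinarith⟩
    linarith
  · have : 1 - p ≤ √(1 - p) := Real.le_sqrt_of_sq_le (by nlinarith)
    linarith
  · rw [sub_sub_cancel, Real.sq_sqrt (by linarith)]

/-- The failure probability of the lower bound for the linear chromatic number. -/
theorem binomialRandom_real_not_le {n : ℕ} {ω : ℝ} {p : unitInterval} (hω : 1 ≤ ω) (hωn : ω ≤ n)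
    (hlog : Real.log ω ≤ √ω / 2) (hp : (p : ℝ) = ω / n) :
    (SimpleGraph.binomialRandom (Fin n) p).real
      {G | ¬ ((n : ℝ) - 510 * n / √ω ≤ linearChromaticNumber G)} ≤ 2 * Real.exp (-n) := by
  have hω0 : 0 < ω := by linarith
  have hn : (0 : ℝ) < n := by linarith
  obtain ⟨q, hq1, hq2, hpq⟩ := exists_two_round_parameter p.2.1 p.2.2
  have hp0 : (0 : ℝ) ≤ p := p.2.1
  have hp1 : (p : ℝ) ≤ 1 := p.2.2
  have hsq : 0 < √ω := Real.sqrt_pos.2 hω0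
  have hsqω : √ω * √ω = ω := Real.mul_self_sqrt hω0.le
  obtain ⟨ρ, hρ⟩ : ∃ ρ, ρ = n / √ω := ⟨_, rfl⟩
  have hρn : ρ * √ω = n := by rw [hρ]; field_simp
  have hρ1 : 1 ≤ ρ := by
    rw [hρ, le_div_iff₀ hsq, one_mul]
    refine le_trans ?_ hωn
    nlinarith [Real.one_le_sqrt.2 hω]
  have hs1 := Nat.le_ceil (50 * ρ)
  have hs2 := Nat.ceil_lt_add_one (show 0 ≤ 50 * ρ by linarith)
  have hm1 := Nat.floor_le (show 0 ≤ 510 * ρ by linarith)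
  have hm2 := Nat.lt_floor_add_one (510 * ρ)
  set s := ⌈50 * ρ⌉₊
  set m := ⌊510 * ρ⌋₊
  have hs : 0 < s := by
    have : (0 : ℝ) < s := by linarith
    exact_mod_cast this
  -- `9 * s + 1 < 450 * ρ + 10`, and the excess of 510 over 450 absorbs the rounding because `1 ≤
  -- ρ`.
  have hsm : 9 * s + 1 ≤ m := by
    have : ((9 * s + 1 : ℕ) : ℝ) < ((m + 1 : ℕ) : ℝ) := by push_cast; linarith
    have : 9 * s + 1 < m + 1 := by exact_mod_cast this
    omega
  have hqs : 1250 * (n : ℝ) ≤ q * s ^ 2 := by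
    have h1 : ω / n / 2 ≤ q := hp ▸ hq1
    have h2 : (50 * ρ) ^ 2 ≤ (s : ℝ) ^ 2 := by gcongr
    have h3 : ω / n / 2 * (50 * ρ) ^ 2 = 1250 * n := by
      rw [hρ, mul_pow, div_pow, Real.sq_sqrt hω0.le]
      field_simp
      norm_num
    calc 1250 * (n : ℝ) = ω / n / 2 * (50 * ρ) ^ 2 := h3.symm
      _ ≤ q * s ^ 2 := by gcongr; linarith
  -- With `w = ω`, the factor `exp (q / w * (n.choose 2))` is at most `exp n`, while `w ^ m` costs
  -- `m * log ω ≤ 255 * n`.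
  have hmain := binomialRandom_linearChromaticNumber_le (V := Fin n) p (q := q) (w := ω)
    (by linarith) (by linarith) hpq hω hs hsm
  rw [Fintype.card_fin] at hmain
  refine (MeasureTheory.measureReal_mono ?_).trans (hmain.trans ?_)
  · intro G hG
    simp only [Set.mem_ofPred_eq, not_le] at hG ⊢
    have h1 : 510 * (n : ℝ) / √ω = 510 * ρ := by rw [hρ]; ring
    rw [h1] at hG
    have h2 : ((m + linearChromaticNumber G : ℕ) : ℝ) ≤ n := by push_cast; linarith
    exact_mod_cast h2
  · have he : (2 : ℝ) ≤ Real.exp 1 := by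
      have := Real.add_one_le_exp (1 : ℝ)
      linarith
    have h2n : (2 : ℝ) ^ n ≤ Real.exp n := by
      rw [← mul_one (n : ℝ), Real.exp_nat_mul]
      gcongr
    have h4n : (4 : ℝ) ^ n ≤ Real.exp (n + n) := by
      rw [Real.exp_add, show (4 : ℝ) = 2 * 2 by norm_num, mul_pow]
      gcongr
    have hA : (4 : ℝ) ^ n * Real.exp (-(q * s ^ 2)) ≤ Real.exp (-n) := by
      calc (4 : ℝ) ^ n * Real.exp (-(q * s ^ 2))
          ≤ Real.exp (n + n) * Real.exp (-(q * s ^ 2)) := by gcongr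
        _ ≤ Real.exp (-n) := by
          rw [← Real.exp_add, Real.exp_le_exp]
          linarith
    have hwm : ω ^ m ≤ Real.exp (255 * n) := by
      calc ω ^ m = Real.exp (m * Real.log ω) := by
            rw [Real.exp_nat_mul, Real.exp_log hω0]
        _ ≤ Real.exp (255 * n) := by
            rw [Real.exp_le_exp, ← hρn]
            calc (m : ℝ) * Real.log ω ≤ 510 * ρ * (√ω / 2) :=
                  mul_le_mul hm1 hlog (Real.log_nonneg hω) (by linarith)
              _ = 255 * (ρ * √ω) := by ring
    have hch : q / ω * (n.choose 2 : ℕ) ≤ n := by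
      have h1 : ((n.choose 2 : ℕ) : ℝ) ≤ n ^ 2 := by exact_mod_cast Nat.choose_le_pow n 2
      have h2 : q / ω ≤ 1 / n := by
        rw [div_le_div_iff₀ hω0 hn, one_mul]
        calc q * n ≤ ω / n * n := by rw [← hp]; gcongr
          _ = ω := by field_simp
      calc q / ω * (n.choose 2 : ℕ) ≤ 1 / n * n ^ 2 := by gcongr
        _ = n := by field_simp
    -- The exponents add up to at most `n + 255 n + n - 625 n`.
    have hB : (2 : ℝ) ^ n * (ω ^ m * Real.exp (q / ω * (n.choose 2 : ℕ))) *
        Real.exp (-(q * s ^ 2 / 2)) ≤ Real.exp (-n) := by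
      calc (2 : ℝ) ^ n * (ω ^ m * Real.exp (q / ω * (n.choose 2 : ℕ))) *
            Real.exp (-(q * s ^ 2 / 2))
          ≤ Real.exp n * (Real.exp (255 * n) * Real.exp n) * Real.exp (-(q * s ^ 2 / 2)) := by
            gcongr
        _ ≤ Real.exp (-n) := by
          rw [← Real.exp_add, ← Real.exp_add, ← Real.exp_add, Real.exp_le_exp]
          linarith
    linarith

/-- The lower bound for the linear chromatic number of a random graph. -/
theorem aas_le_linearChromaticNumber (ω : ℕ → ℝ) (p : ℕ → unitInterval)
    (hω : Tendsto ω atTop atTop) (hωn : ∀ᶠ n : ℕ in atTop, ω n ≤ n)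
    (hp : ∀ᶠ n : ℕ in atTop, (p n : ℝ) = ω n / n) :
    AAS p (fun n G => (n : ℝ) - 510 * n / √(ω n) ≤ linearChromaticNumber G) := by
  have hε : Tendsto (fun n : ℕ => 2 * Real.exp (-(n : ℝ))) atTop (𝓝 0) := by
    simpa using (Real.tendsto_exp_neg_atTop_nhds_zero.comp
      tendsto_natCast_atTop_atTop).const_mul (2 : ℝ)
  have hlog : ∀ᶠ x : ℝ in atTop, Real.log x ≤ √x / 2 := by
    have h := (isLittleO_log_rpow_atTop (show (0 : ℝ) < 1 / 2 by norm_num)).bound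
      (show (0 : ℝ) < 1 / 2 by norm_num)
    filter_upwards [h] with x hx
    rw [← Real.sqrt_eq_rpow, Real.norm_of_nonneg (Real.sqrt_nonneg x)] at hx
    have := Real.le_norm_self (Real.log x)
    linarith
  refine aas_of_le hε ?_
  filter_upwards [hω.eventually_ge_atTop 1, hωn, hp, hω.eventually hlog] with n h1 h2 h3 h4
  exact binomialRandom_real_not_le h1 h2 h4 h3

theorem binomialRandom_half_real (n : ℕ) (p : unitInterval) (hp : (p : ℝ) = 1 / 2)
    (Q : Set (SimpleGraph (Fin n))) :
    (SimpleGraph.binomialRandom (Fin n) p).real Q =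
      (Q.ncard : ℝ) / (Nat.card (SimpleGraph (Fin n)) : ℝ) := by
  classical
  have := measurableSingletonClass_simpleGraph (V := Fin n)
  have h1 : ∀ G : SimpleGraph (Fin n),
      (SimpleGraph.binomialRandom (Fin n) p).real {G} = (1 / 2) ^ n.choose 2 := by
    intro G
    have hle : G.edgeSet.ncard ≤ n.choose 2 := by
      have := G.card_edgeFinset_le_card_choose_two
      rwa [Fintype.card_fin, ← Set.ncard_coe_finset, SimpleGraph.coe_edgeFinset] at this
    rw [MeasureTheory.measureReal_def, SimpleGraph.binomialRandom_singleton]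
    simp only [Nat.card_fin, ENNReal.toReal_mul, ENNReal.toReal_pow, ENNReal.coe_toReal,
      unitInterval.coe_toNNReal, unitInterval.coe_symm_eq, hp]
    rw [show (1 : ℝ) - 1 / 2 = 1 / 2 by norm_num, ← pow_add, Nat.add_sub_cancel' hle]
  have h2 : ∀ R : Set (SimpleGraph (Fin n)),
      (SimpleGraph.binomialRandom (Fin n) p).real R = R.ncard * (1 / 2) ^ n.choose 2 := by
    intro R
    rw [← R.toFinite.coe_toFinset, ← MeasureTheory.sum_measureReal_singleton,
      Finset.sum_congr rfl fun G _ => h1 G, Finset.sum_const, Set.ncard_coe_finset, nsmul_eq_mul]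
  -- Total mass 1 gives the number of graphs as the inverse of the common weight, without counting
  -- them.
  have h3 := h2 Set.univ
  rw [MeasureTheory.probReal_univ, Set.ncard_univ] at h3
  rw [h2 Q, eq_div_iff (by rintro h; rw [h] at h3; simp at h3)]
  linear_combination (-(Q.ncard : ℝ)) * h3

/-- The linear and the centred chromatic number of a random graph are asymptotically `n`. -/
theorem aas_abs_sub_le (p : ℕ → unitInterval)
    (hp : Tendsto (fun n : ℕ => (n : ℝ) * (p n : ℝ)) atTop atTop) :
    (∃ δ : ℕ → ℝ, Tendsto δ atTop (𝓝 0) ∧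
      AAS p (fun n G => |(linearChromaticNumber G : ℝ) - n| ≤ δ n * n ∧
        |(linearChromaticNumber G : ℝ) - centredChromaticNumber G| ≤
          δ n * centredChromaticNumber G)) ∧
    AAS p (fun _ G => centredChromaticNumber G ≤ 2 * linearChromaticNumber G) := by
  have hmain := aas_le_linearChromaticNumber (fun n => (n : ℝ) * (p n : ℝ)) p hp
    (Eventually.of_forall fun n => mul_le_of_le_one_right (Nat.cast_nonneg n) (p n).2.2)
    (by
      filter_upwards [eventually_ge_atTop 1] with n hn
      have : (n : ℝ) ≠ 0 := by positivity
      field_simp)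
  have hsqrt : Tendsto (fun n : ℕ => √((n : ℝ) * (p n : ℝ))) atTop atTop :=
    Real.tendsto_sqrt_atTop.comp hp
  have hev : ∀ᶠ n : ℕ in atTop, ∀ G : SimpleGraph (Fin n),
      (n : ℝ) - 510 * n / √((n : ℝ) * (p n : ℝ)) ≤ linearChromaticNumber G →
      (linearChromaticNumber G : ℝ) ≤ centredChromaticNumber G ∧
      (centredChromaticNumber G : ℝ) ≤ n ∧ (n : ℝ) ≤ 2 * linearChromaticNumber G ∧
      (n : ℝ) - linearChromaticNumber G ≤ 510 / √((n : ℝ) * (p n : ℝ)) * n ∧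
      0 ≤ 510 / √((n : ℝ) * (p n : ℝ)) := by
    -- The threshold `1020 = 2 * 510` makes the relative error at most `1 / 2`, hence `n ≤ 2 *
    -- linearChromaticNumber G`.
    filter_upwards [hsqrt.eventually_ge_atTop 1020] with n hn G hG
    have h1 : 510 / √((n : ℝ) * (p n : ℝ)) ≤ 1 / 2 := by
      rw [div_le_div_iff₀ (by linarith) (by norm_num)]
      linarith
    have h2 : 510 * (n : ℝ) / √((n : ℝ) * (p n : ℝ)) = 510 / √((n : ℝ) * (p n : ℝ)) * n := by ring
    rw [h2] at hG
    have h3 : (0 : ℝ) ≤ n := Nat.cast_nonneg n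
    refine ⟨by exact_mod_cast linearChromaticNumber_le_centredChromaticNumber G, ?_, ?_, ?_, ?_⟩
    · have := centredChromaticNumber_le G
      rw [Nat.card_fin] at this
      exact_mod_cast this
    · nlinarith
    · linarith
    · positivity
  -- The factor 2 converts an error relative to `n` into one relative to the centred chromatic
  -- number, which is at least `n / 2`.
  refine ⟨⟨fun n => 2 * (510 / √((n : ℝ) * (p n : ℝ))), ?_, ?_⟩, ?_⟩
  · simpa using (hsqrt.const_div_atTop 510).const_mul 2
  · refine hmain.mono ?_
    filter_upwards [hev] with n hn G hG
    obtain ⟨h1, h2, h3, h4, h5⟩ := hn G hG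
    have h6 : (0 : ℝ) ≤ n := Nat.cast_nonneg n
    rw [abs_sub_comm, abs_of_nonneg (by linarith), abs_sub_comm, abs_of_nonneg (by linarith)]
    constructor <;> nlinarith
  · refine hmain.mono ?_
    filter_upwards [hev] with n hn G hG
    obtain ⟨h1, h2, h3, -, -⟩ := hn G hG
    exact_mod_cast h2.trans h3

/-- Almost all graphs satisfy the inequality between the two chromatic numbers. -/
theorem almostAllGraphs_centredChromaticNumber_le :
    AlmostAllGraphs (fun _ G => centredChromaticNumber G ≤ 2 * linearChromaticNumber G) := by
  let p : unitInterval := ⟨1 / 2, by norm_num, by norm_num⟩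
  have h := (aas_abs_sub_le (fun _ => p)
    (tendsto_natCast_atTop_atTop.atTop_mul_const (show (0 : ℝ) < 1 / 2 by norm_num))).2
  unfold AAS at h
  simp only [binomialRandom_half_real _ p rfl] at h
  exact h

end Asymptotics

end LinearColouring

theorem mainTheorem1 :
    -- the lower bound
    (∀ (ω : ℕ → ℝ) (p : ℕ → unitInterval),
      Tendsto ω atTop atTop → (∀ᶠ n : ℕ in atTop, ω n ≤ n) →
      (∀ᶠ n : ℕ in atTop, (p n : ℝ) = ω n / n) →
      LinearColouring.AAS p (fun n G =>
        (n : ℝ) - 510 * n / Real.sqrt (ω n) ≤ LinearColouring.linearChromaticNumber G)) ∧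
    -- the consequences for `n * p → ∞`
    (∀ p : ℕ → unitInterval, Tendsto (fun n : ℕ => (n : ℝ) * (p n : ℝ)) atTop atTop →
      (∃ δ : ℕ → ℝ, Tendsto δ atTop (𝓝 0) ∧
        LinearColouring.AAS p (fun n G =>
          |(LinearColouring.linearChromaticNumber G : ℝ) - n| ≤ δ n * n ∧
          |(LinearColouring.linearChromaticNumber G : ℝ) -
              LinearColouring.centredChromaticNumber G| ≤
            δ n * LinearColouring.centredChromaticNumber G)) ∧
      LinearColouring.AAS p (fun _ G =>
        LinearColouring.centredChromaticNumber G ≤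
          2 * LinearColouring.linearChromaticNumber G)) ∧
    -- almost all graphs
    LinearColouring.AlmostAllGraphs (fun _ G =>
      LinearColouring.centredChromaticNumber G ≤
        2 * LinearColouring.linearChromaticNumber G) :=
  ⟨LinearColouring.aas_le_linearChromaticNumber, LinearColouring.aas_abs_sub_le,
    LinearColouring.almostAllGraphs_centredChromaticNumber_le⟩
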